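/- Let either (N) $K\subset\mathbb R^2$ be a bounded open set (for example the square $(-L,L)^2$), with homogeneous Neumann boundary conditions, or (P) $K=(-L,L)^2$ with $L>0$, with periodic boundary conditions. Let $\mathcal D$ be, in case (N), the set of $C^1$ functions with compact support in $K$ and, in case (P), the set of $C^1$ functions on $\mathbb R^2$ that are $2L$-periodic in each variable. A function $u\in L^2(K)$ belongs to $H^1(K)$ (in case (P): to the periodic space $H^1$) if there is $\nabla u=(u_{x_1},u_{x_2})\in L^2(K)^2$ with $\int_K u\,\varphi_{x_i}\,dx=-\int_K u_{x_i}\varphi\,dx$ for all $\varphi\in\mathcal D$ and $i=1,2$; its norm is given by $\|u\|_{H^1}^2=\|u\|_{L^2(K)}^2+\|u_{x_1}\|_{L^2(K)}^2+\|u_{x_2}\|_{L^2(K)}^2$. For $\gamma\ge 0$ consider the equation $$u_t=\gamma\Delta u+\operatorname{div}\Big(\frac{u_{x_1}}{|u_{x_1}|},\frac{u_{x_2}}{|u_{x_2}|}\Big),$$ understood as the gradient flow in $L^2(K)$ of the functional $\Phi:L^2(K)\to[0,\infty]$ given, for $\gamma>0$, by $$\Phi(u)=\int_K\frac\gamma2|\nabla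 u|^2+|u_{x_1}|+|u_{x_2}|\,dx\ \text{ if } u\in H^1(K),\qquad \Phi(u)=+\infty\ \text{ otherwise},$$ and, for $\gamma=0$, by $$\Phi(u)=\sup\Big\{\int_K u\,\operatorname{div}z\,dx:\ z=(z_1,z_2),\ z_1,z_2\in\mathcal D,\ \max(|z_1|,|z_2|)\le1\Big\}$$ (which is finite exactly when $u$ has bounded variation). That is, a solution with initial datum $u_0\in L^2(K)$ is a continuous function $u:[0,\infty)\to L^2(K)$ with $u(0)=u_0$ that has at every $t>0$ a right derivative $u_t(t)=\frac{d^+u}{dt}(t)$ in $L^2(K)$ with $-u_t(t)\in\partial\Phi(u(t))$. Then for every $M$ there is a constant $C$, depending only on $K$, the boundary conditions, $\gamma$ and $M$, such that for every $u_0\in H^1(K)$ with $\|u_0\|_{H^1}\le M$, the solution $u$ with initial datum $u_0$ satisfies $$\|u_t(t)\|_{L^2(K)}\le C\,t^{-1/2}\qquad\text{for all } t>0 .$$ -/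

import Mathlib

open MeasureTheory Set
open scoped ENNReal

noncomputable section

namespace AnisoTV

/-- The plane `ℝ²` with its Euclidean norm. -/
abbrev Plane : Type := EuclideanSpace ℝ (Fin 2)

/-- The real Hilbert space `L²(K)`. -/
abbrev L2 (K : Set Plane) : Type := Lp ℝ 2 ((volume : Measure Plane).restrict K)

/-- The classical partial derivative `∂φ/∂xᵢ` of a function on the plane. -/
def partialDeriv (i : Fin 2) (φ : Plane → ℝ) (x : Plane) : ℝ :=
  fderiv ℝ φ x (EuclideanSpace.single i 1)

/-- The open square `(-L, L)²`. -/
def square (L : ℝ) : Set Plane := {x | ∀ i, x i ∈ Ioo (-L) L}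

/-- `C¹` functions with compact support in `K`.  Weak derivatives against these are the weak
derivatives of functions on `K`, with no condition on the boundary, so that the homogeneous
Neumann condition is the natural boundary condition of the energies below. -/
def interiorTests (K : Set Plane) : Set (Plane → ℝ) :=
  {φ | ContDiff ℝ 1 φ ∧ HasCompactSupport φ ∧ tsupport φ ⊆ K}

/-- `C¹` functions on the plane with period `2L` in each variable.  Weak derivatives against
these are the weak derivatives on the torus obtained from the square `(-L, L)²`. -/
def periodicTests (L : ℝ) : Set (Plane → ℝ) :=
  {φ | ContDiff ℝ 1 φ ∧ ∀ i x, φ (x + EuclideanSpace.single i (2 * L)) = φ x}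

/-- The two boundary value problems: the homogeneous Neumann problem on a bounded open set `K`,
and the periodic problem on the square `(-L, L)²`.  Both are encoded by the domain and
the class of test functions that defines weak derivatives. -/
inductive BoundarySetting : Set Plane → Set (Plane → ℝ) → Prop
  | neumann {K : Set Plane} (isOpen : IsOpen K) (isBounded : Bornology.IsBounded K) :
      BoundarySetting K (interiorTests K)
  | periodic {L : ℝ} (pos : 0 < L) : BoundarySetting (square L) (periodicTests L)

/-- `g = (g₀, g₁) ∈ L²(K)²` is the weak gradient of `u ∈ L²(K)` (tested against `𝒟`). -/
def IsWeakGradient (K : Set Plane) (𝒟 : Set (Plane → ℝ)) (u : L2 K) (g : Fin 2 → L2 K) : Prop :=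
  ∀ i, ∀ φ ∈ 𝒟, ∫ x in K, u x * partialDeriv i φ x = -∫ x in K, g i x * φ x

/-- `u` belongs to the Sobolev space `H¹` and its `H¹` norm is at most `M`. -/
def H1NormLE (K : Set Plane) (𝒟 : Set (Plane → ℝ)) (u : L2 K) (M : ℝ) : Prop :=
  0 ≤ M ∧ ∃ g : Fin 2 → L2 K, IsWeakGradient K 𝒟 u g ∧ ‖u‖ ^ 2 + ∑ i, ‖g i‖ ^ 2 ≤ M ^ 2

/-- The anisotropic total variation `∫_K (|u_{x₁}| + |u_{x₂}|)`, that is, the supremum of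
`∫_K u div z` over the test fields `z` with `|z|_∞ ≤ 1`.  On a bounded set `K`
it is finite exactly on the functions of `L²(K)` that have bounded variation. -/
def anisoTV (K : Set Plane) (𝒟 : Set (Plane → ℝ)) (u : L2 K) : ℝ≥0∞ :=
  ⨆ z ∈ {z : Fin 2 → Plane → ℝ | (∀ i, z i ∈ 𝒟) ∧ ∀ i x, |z i x| ≤ 1},
    ENNReal.ofReal (∫ x in K, u x * ∑ i, partialDeriv i (z i) x)

/-- The energy `∫_K (γ/2) |∇u|² + |u_{x₁}| + |u_{x₂}|` on `H¹`, and `+∞` elsewhere.  The weak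
gradient is unique, so the infimum is over at most one value; over none it is `+∞`. -/
def diffEnergy (K : Set Plane) (𝒟 : Set (Plane → ℝ)) (γ : ℝ) (u : L2 K) : ℝ≥0∞ :=
  ⨅ g ∈ {g : Fin 2 → L2 K | IsWeakGradient K 𝒟 u g},
    ENNReal.ofReal (∫ x in K, (γ / 2 * ∑ i, g i x ^ 2 + ∑ i, |g i x|))

/-- The energy whose gradient flow is the equation
`u_t = γ Δu + div (u_{x₁}/|u_{x₁}|, u_{x₂}/|u_{x₂}|)`: for `γ = 0` its domain is `BV`, for `γ > 0` its
domain is `H¹`. -/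
def energy (K : Set Plane) (𝒟 : Set (Plane → ℝ)) (γ : ℝ) (u : L2 K) : ℝ≥0∞ :=
  open Classical in if γ = 0 then anisoTV K 𝒟 u else diffEnergy K 𝒟 γ u

/-- The subdifferential of a function `Φ : H → [0, ∞]` on a real Hilbert space. -/
def subdifferential {H : Type*} [NormedAddCommGroup H] [InnerProductSpace ℝ H]
    (Φ : H → ℝ≥0∞) (u : H) : Set H :=
  {ξ | Φ u ≠ ⊤ ∧
    ∀ w, ((Φ u : ℝ≥0∞) : EReal) + ((inner ℝ ξ (w - u) : ℝ) : EReal) ≤ ((Φ w : ℝ≥0∞) : EReal)}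

/-- `u : [0, ∞) → H` is the gradient flow (semigroup solution) of `Φ` starting at `u₀`: it is
continuous, `u(0) = u₀`, and at every `t > 0` it has a right derivative `d⁺u/dt`
with `d⁺u/dt + ∂Φ(u(t)) ∋ 0`. -/
structure IsGradientFlow {H : Type*} [NormedAddCommGroup H] [InnerProductSpace ℝ H]
    (Φ : H → ℝ≥0∞) (u₀ : H) (u : ℝ → H) : Prop where
  continuousOn : ContinuousOn u (Ici 0)
  initial : u 0 = u₀
  inclusion : ∀ t, 0 < t → ∃ v, HasDerivWithinAt u v (Ioi t) t ∧ -v ∈ subdifferential Φ (u t)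

end AnisoTV

end

open Filter Topology

namespace AnisoTV

/-! This is the regularizing effect of gradient flows started at finite energy,
`IsGradientFlow.exists_mul_norm_sq_le`. Monotonicity of the subdifferential makes the speed
nonincreasing, while dissipation bounds the time integral of the squared speed by a multiple of the
initial energy; hence `t ‖u_t(t)‖²` is at most such a multiple.

No chain rule for the energy is used: `norm_sub_sq_le_energy_sub` bounds finite increments of the
flow by energy drops, which are summed over a uniform partition of `[0, t]`. This costs a factor 2.
The only input from the equation is that an `H¹` bound controls the energy: `diffEnergy_le` and
`anisoTV_le`. -/

theorem sub_le_mul_of_rightDeriv_le {f : ℝ → ℝ} {a b c : ℝ} (hab : a ≤ b)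
    (hf : ContinuousOn f (Icc a b))
    (hf' : ∀ x ∈ Ioo a b, ∃ d, HasDerivWithinAt f d (Ioi x) x ∧ d ≤ c) :
    f b - f a ≤ c * (b - a) := by
  rcases hab.eq_or_lt with rfl | hab
  · simp
  choose! f' hd hle using hf'
  -- Nothing is known about the derivative at `a` (a flow need not have one at time 0), so the
  -- estimate is made on `[a', b]`, and then `a'` tends to `a`.
  have key : ∀ a' ∈ Ioo a b, f b - f a' ≤ c * (b - a') := by
    intro a' ha'
    have := image_le_of_deriv_right_le_deriv_boundary (f := f) (f' := f') (a := a') (b := b)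
      (B := fun x => f a' + c * (x - a')) (B' := fun _ => c)
      (hf.mono (Icc_subset_Icc_left ha'.1.le))
      (fun x hx => (hd x ⟨ha'.1.trans_le hx.1, hx.2⟩).Ici_of_Ioi) (by simp) (by fun_prop)
      (fun x _ => by
        simpa using ((((hasDerivAt_id x).sub_const a').const_mul c).const_add (f a')).hasDerivWithinAt)
      (fun x hx => hle x ⟨ha'.1.trans_le hx.1, hx.2⟩) (right_mem_Icc.2 ha'.2.le)
    linarith
  have hlim : Tendsto f (𝓝[>] a) (𝓝 (f a)) :=
    ((hf a (left_mem_Icc.2 hab.le)).mono Ioo_subset_Icc_self).tendsto.mono_left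
      (nhdsWithin_Ioo_eq_nhdsGT hab).ge
  have hid : Tendsto (fun x : ℝ => x) (𝓝[>] a) (𝓝 a) := tendsto_nhdsWithin_of_tendsto_nhds tendsto_id
  exact le_of_tendsto_of_tendsto (tendsto_const_nhds.sub hlim)
    ((tendsto_const_nhds.sub hid).const_mul c)
    (by filter_upwards [Ioo_mem_nhdsGT hab] with x hx using key x hx)

theorem tendsto_slope_zero_of_hasDerivWithinAt_Ioi {E : Type*} [NormedAddCommGroup E]
    [NormedSpace ℝ E] {f : ℝ → E} {f' : E} {x : ℝ} (hf : HasDerivWithinAt f f' (Ioi x) x) :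
    Tendsto (fun h : ℝ => h⁻¹ • (f (x + h) - f x)) (𝓝[>] 0) (𝓝 f') := by
  have h1 := (hasDerivWithinAt_iff_tendsto_slope' self_notMem_Ioi).1 hf
  have h2 : Tendsto (fun h : ℝ => x + h) (𝓝[>] 0) (𝓝[>] x) := by
    refine tendsto_nhdsWithin_iff.2 ⟨tendsto_nhdsWithin_of_tendsto_nhds ?_, ?_⟩
    · simpa using (continuous_const_add x).tendsto 0
    · filter_upwards [self_mem_nhdsWithin] with h hh using lt_add_of_pos_right x hh
  simpa [Function.comp_def, slope_def_module] using h1.comp h2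

/-! ### Abstract gradient flows in a Hilbert space -/

section GradientFlow

variable {H : Type*} [NormedAddCommGroup H] [InnerProductSpace ℝ H] {Φ : H → ℝ≥0∞}

theorem toReal_add_inner_le_of_mem_subdifferential {ξ u w : H} (h : ξ ∈ subdifferential Φ u)
    (hw : Φ w ≠ ⊤) : (Φ u).toReal + inner ℝ ξ (w - u) ≤ (Φ w).toReal := by
  have h1 := h.2 w
  rw [← ENNReal.ofReal_toReal h.1, ← ENNReal.ofReal_toReal hw,
    EReal.coe_ennreal_ofReal, EReal.coe_ennreal_ofReal, max_eq_left ENNReal.toReal_nonneg,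
    max_eq_left ENNReal.toReal_nonneg] at h1
  exact_mod_cast h1

theorem inner_sub_nonneg_of_mem_subdifferential {ξ η u w : H} (hξ : ξ ∈ subdifferential Φ u)
    (hη : η ∈ subdifferential Φ w) : 0 ≤ inner ℝ (ξ - η) (u - w) := by
  have h1 := toReal_add_inner_le_of_mem_subdifferential hξ hη.1
  have h2 := toReal_add_inner_le_of_mem_subdifferential hη hξ.1
  rw [← neg_sub u w, inner_neg_right] at h1
  rw [inner_sub_left]
  linarith

namespace IsGradientFlow

variable {u₀ : H} {u : ℝ → H}

theorem energy_ne_top (hu : IsGradientFlow Φ u₀ u) {t : ℝ} (ht : 0 < t) : Φ (u t) ≠ ⊤ := by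
  obtain ⟨v, -, hv⟩ := hu.inclusion t ht
  exact hv.1

/-- The flow and its time shift follow the same inclusion, so by monotonicity of the subdifferential
their squared distance has nonpositive right derivative. -/
theorem antitoneOn_norm_sub (hu : IsGradientFlow Φ u₀ u) {h : ℝ} (hh : 0 ≤ h) :
    AntitoneOn (fun t => ‖u (t + h) - u t‖) (Ici 0) := by
  intro a ha b hb hab
  have hc : ContinuousOn (fun t => ‖u (t + h) - u t‖ ^ 2) (Ici 0) := by
    refine ((hu.continuousOn.comp (by fun_prop) fun x hx => ?_).sub hu.continuousOn).norm.pow 2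
    exact add_nonneg hx hh
  have := sub_le_mul_of_rightDeriv_le (c := 0) hab (hc.mono fun x hx => le_trans ha hx.1) ?_
  · refine le_of_sq_le_sq ?_ (norm_nonneg _)
    simp only at this ⊢
    linarith
  · intro x hx
    have hx0 : 0 < x := lt_of_le_of_lt ha hx.1
    obtain ⟨v, hv, hv'⟩ := hu.inclusion x hx0
    obtain ⟨w, hw, hw'⟩ := hu.inclusion (x + h) (by positivity)
    have hw2 : HasDerivWithinAt (fun t => u (t + h)) w (Ioi x) x := by
      have := HasDerivWithinAt.scomp x (t' := Ioi (x + h)) hw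
        ((hasDerivWithinAt_id x (Ioi x)).add_const h) (fun y hy => by simpa using hy)
      simpa [Function.comp_def] using this
    refine ⟨_, (hw2.sub hv).norm_sq, ?_⟩
    have h1 := inner_sub_nonneg_of_mem_subdifferential hw' hv'
    rw [show -w - -v = -(w - v) by abel, inner_neg_left, real_inner_comm] at h1
    simp only [Pi.sub_apply]
    linarith

/-- Divide the increments in `antitoneOn_norm_sub` by `h` and let `h` tend to 0. -/
theorem norm_le_of_le (hu : IsGradientFlow Φ u₀ u) {s t : ℝ} (hs : 0 < s) (hst : s ≤ t) {v w : H}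
    (hv : HasDerivWithinAt u v (Ioi s) s) (hw : HasDerivWithinAt u w (Ioi t) t) : ‖w‖ ≤ ‖v‖ := by
  have lim : ∀ {r : ℝ} {z : H}, HasDerivWithinAt u z (Ioi r) r →
      Tendsto (fun h : ℝ => h⁻¹ * ‖u (r + h) - u r‖) (𝓝[>] 0) (𝓝 ‖z‖) := by
    intro r z hz
    refine (tendsto_slope_zero_of_hasDerivWithinAt_Ioi hz).norm.congr' ?_
    filter_upwards [self_mem_nhdsWithin] with h hh
    rw [norm_smul, Real.norm_of_nonneg (inv_nonneg.2 (le_of_lt hh))]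
  refine le_of_tendsto_of_tendsto (lim hw) (lim hv) ?_
  filter_upwards [self_mem_nhdsWithin] with h hh
  have hh' : (0 : ℝ) < h := hh
  exact mul_le_mul_of_nonneg_left
    (hu.antitoneOn_norm_sub hh'.le hs.le (hs.le.trans hst) hst) (inv_nonneg.2 hh'.le)

/-- The subgradient inequality tested with `w` bounds the right derivative of `‖u - w‖²` by `2 (Φ w
- Φ u)`. -/
theorem norm_sub_sq_le (hu : IsGradientFlow Φ u₀ u) {a b m : ℝ} {w : H} (ha : 0 ≤ a)
    (hab : a ≤ b) (hw : Φ w ≠ ⊤) (hm : ∀ r ∈ Ioo a b, m ≤ (Φ (u r)).toReal) :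
    ‖u b - w‖ ^ 2 - ‖u a - w‖ ^ 2 ≤ 2 * ((Φ w).toReal - m) * (b - a) := by
  refine sub_le_mul_of_rightDeriv_le (f := fun r => ‖u r - w‖ ^ 2) hab ?_ ?_
  · exact ((hu.continuousOn.mono fun x hx => ha.trans hx.1).sub continuousOn_const).norm.pow 2
  · intro x hx
    obtain ⟨v, hv, hv'⟩ := hu.inclusion x (ha.trans_lt hx.1)
    refine ⟨_, (hv.sub_const w).norm_sq, ?_⟩
    have h1 := toReal_add_inner_le_of_mem_subdifferential hv' hw
    rw [inner_neg_left, ← inner_neg_right, neg_sub, real_inner_comm] at h1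
    have h2 := hm x hx
    linarith

/-- After time `t / 2` all subgradients `-u_t` are bounded by the speed at `t / 2`, so the
subgradient inequality, used both ways, makes energy differences Lipschitz in `u`. -/
theorem continuousOn_energy (hu : IsGradientFlow Φ u₀ u) :
    ContinuousOn (fun t => (Φ (u t)).toReal) (Ioi 0) := by
  intro t (ht : 0 < t)
  obtain ⟨v, hv, -⟩ := hu.inclusion (t / 2) (half_pos ht)
  have one : ∀ r ∈ Ioi (t / 2), ∀ s ∈ Ioi (t / 2),
      (Φ (u r)).toReal - (Φ (u s)).toReal ≤ ‖v‖ * ‖u r - u s‖ := by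
    intro r hr s hs
    have hr0 : 0 < r := (half_pos ht).trans hr
    obtain ⟨w, hw, hw'⟩ := hu.inclusion r hr0
    have h1 := toReal_add_inner_le_of_mem_subdifferential hw'
      (hu.energy_ne_top ((half_pos ht).trans hs))
    have h2 := real_inner_le_norm w (u s - u r)
    have h3 := mul_le_mul_of_nonneg_right (hu.norm_le_of_le (half_pos ht) (le_of_lt hr) hv hw)
      (norm_nonneg (u r - u s))
    rw [inner_neg_left] at h1
    rw [norm_sub_rev] at h2
    linarith
  have hcont : ContinuousAt u t := hu.continuousOn.continuousAt (Ici_mem_nhds ht)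
  have htt : t ∈ Ioi (t / 2) := by simp [ht]
  refine ContinuousAt.continuousWithinAt ?_
  rw [ContinuousAt, tendsto_iff_norm_sub_tendsto_zero] at hcont ⊢
  refine squeeze_zero' (Eventually.of_forall fun _ => norm_nonneg _) ?_
    (by simpa using hcont.const_mul ‖v‖)
  filter_upwards [Ioi_mem_nhds htt] with s hs
  rw [Real.norm_eq_abs, abs_le]
  have h1 := one s hs t htt
  have h2 := one t htt s hs
  rw [norm_sub_rev] at h2
  constructor <;> linarith

/-- If the energy were larger at `b` than at `a`, its last minimum point `q` on `[a, b]` would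
precede `b`. But a flow whose energy stays at least that of `u q` cannot move away from `u q`, so
`b` would be a minimum point too. -/
theorem antitoneOn_energy_Ioi (hu : IsGradientFlow Φ u₀ u) :
    AntitoneOn (fun t => (Φ (u t)).toReal) (Ioi 0) := by
  intro a (ha : 0 < a) b _ hab
  by_contra! hlt
  set φ : ℝ → ℝ := fun t => (Φ (u t)).toReal with hφ
  have hc : ContinuousOn φ (Icc a b) := hu.continuousOn_energy.mono fun x hx => ha.trans_le hx.1
  obtain ⟨p, hp, hpmin⟩ := isCompact_Icc.exists_isMinOn (nonempty_Icc.2 hab) hc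
  -- the last point of `[a, b]` at which the energy is minimal
  have hS : IsCompact (Icc a b ∩ φ ⁻¹' {φ p}) :=
    isCompact_Icc.of_isClosed_subset (hc.preimage_isClosed_of_isClosed isClosed_Icc isClosed_singleton)
      inter_subset_left
  obtain ⟨q, ⟨hq, hqp⟩, hqmax⟩ := hS.exists_isGreatest ⟨p, hp, rfl⟩
  have hqp : φ q = φ p := hqp
  have hqb : q < b := by
    refine lt_of_le_of_ne hq.2 fun h => ?_
    have := hpmin (left_mem_Icc.2 hab)
    change φ p ≤ φ a at this
    rw [← hqp, h] at this
    exact absurd this (not_le.2 hlt)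
  -- With `w = u q` and `m` the minimum, which is the energy of `u q`, the right-hand side vanishes.
  have h1 := hu.norm_sub_sq_le (w := u q) (m := φ p) (ha.le.trans hq.1) hqb.le
    (hu.energy_ne_top (ha.trans_le hq.1)) fun r hr => hpmin ⟨hq.1.trans hr.1.le, hr.2.le⟩
  have h2 : u b = u q := by
    rw [← hqp] at h1
    simp only [hφ, sub_self, mul_zero, zero_mul, norm_zero, ne_eq, OfNat.ofNat_ne_zero,
      not_false_eq_true, zero_pow, sub_zero] at h1
    have := pow_eq_zero_iff (two_ne_zero) |>.1 (le_antisymm h1 (sq_nonneg _))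
    exact sub_eq_zero.1 (norm_eq_zero.1 this)
  have h3 : b ≤ q := hqmax ⟨right_mem_Icc.2 hab, (congrArg (fun w => (Φ w).toReal) h2).trans hqp⟩
  exact absurd h3 (not_le.2 hqb)

/-- A discrete dissipation inequality. Monotonicity of the energy is needed only at positive times,
so `a = 0` is allowed. -/
theorem norm_sub_sq_le_energy_sub (hu : IsGradientFlow Φ u₀ u) (h₀ : Φ u₀ ≠ ⊤) {a b : ℝ}
    (ha : 0 ≤ a) (hab : a < b) :
    ‖u b - u a‖ ^ 2 ≤ 2 * ((Φ (u a)).toReal - (Φ (u b)).toReal) * (b - a) := by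
  have hfin : Φ (u a) ≠ ⊤ := by
    rcases ha.eq_or_lt with rfl | ha
    · rwa [hu.initial]
    · exact hu.energy_ne_top ha
  simpa using hu.norm_sub_sq_le (w := u a) ha hab.le hfin fun r hr =>
    hu.antitoneOn_energy_Ioi (ha.trans_lt hr.1) (ha.trans_lt hab) hr.2.le

/-- The regularizing effect of a gradient flow whose initial datum has finite energy. -/
theorem exists_mul_norm_sq_le (hu : IsGradientFlow Φ u₀ u) (h₀ : Φ u₀ ≠ ⊤) {t : ℝ} (ht : 0 < t) :
    ∃ v, HasDerivWithinAt u v (Ioi t) t ∧ ‖v‖ ^ 2 * t ≤ 2 * (Φ u₀).toReal := by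
  obtain ⟨v, hv, -⟩ := hu.inclusion t ht
  refine ⟨v, hv, ?_⟩
  -- Cut `[0, t]` into `n + 1` steps of length `h`. The increment `δ` just after `t` is at most the
  -- increment over each step, and the energy drops telescope, so `(n + 1) δ² ≤ 2 h Φ u₀`.
  have key : ∀ n : ℕ, ‖(t / (n + 1 : ℝ))⁻¹ • (u (t + t / (n + 1 : ℝ)) - u t)‖ ^ 2 * t
      ≤ 2 * (Φ u₀).toReal := by
    intro n
    set h : ℝ := t / (n + 1 : ℝ) with hh
    have hpos : 0 < h := by positivity
    set δ : ℝ := ‖u (t + h) - u t‖ with hδ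
    have hstep : ∀ k ∈ Finset.range (n + 1), δ ^ 2 ≤
        2 * h * ((Φ (u (k * h))).toReal - (Φ (u ((k + 1 : ℕ) * h))).toReal) := by
      intro k hk
      have hk' : (k : ℝ) ≤ n + 1 := by
        have := Finset.mem_range.1 hk
        exact_mod_cast this.le
      have hkt : (k : ℝ) * h ≤ t := by
        rw [hh, mul_div_assoc', div_le_iff₀ (by positivity), mul_comm]
        exact mul_le_mul_of_nonneg_left hk' ht.le
      have hk0 : (0 : ℝ) ≤ k * h := by positivity
      have e : ((k + 1 : ℕ) : ℝ) * h = k * h + h := by push_cast; ring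
      have h1 := hu.norm_sub_sq_le_energy_sub h₀ hk0 (lt_add_of_pos_right _ hpos)
      have h2 : δ ≤ ‖u (k * h + h) - u (k * h)‖ := hu.antitoneOn_norm_sub hpos.le hk0 ht.le hkt
      have h3 := pow_le_pow_left₀ (norm_nonneg _) h2 2
      rw [e]
      calc δ ^ 2 ≤ _ := h3.trans h1
        _ = _ := by ring
    have hsum := Finset.sum_le_sum hstep
    rw [← Finset.mul_sum, Finset.sum_range_sub' (fun k : ℕ => (Φ (u (k * h))).toReal)] at hsum
    simp only [Finset.sum_const, Finset.card_range, nsmul_eq_mul, Nat.cast_zero, zero_mul,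
      hu.initial] at hsum
    have hnh : ((n + 1 : ℕ) : ℝ) * h = t := by rw [hh]; push_cast; field_simp
    rw [norm_smul, mul_pow, norm_inv, Real.norm_of_nonneg hpos.le]
    have hle : ((n + 1 : ℕ) : ℝ) * δ ^ 2 ≤ 2 * h * (Φ u₀).toReal := hsum.trans
      (mul_le_mul_of_nonneg_left (sub_le_self _ ENNReal.toReal_nonneg) (by positivity))
    calc h⁻¹ ^ 2 * δ ^ 2 * t = h⁻¹ * (((n + 1 : ℕ) : ℝ) * δ ^ 2) := by
          rw [← hnh]; field_simp
      _ ≤ h⁻¹ * (2 * h * (Φ u₀).toReal) := mul_le_mul_of_nonneg_left hle (by positivity)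
      _ = 2 * (Φ u₀).toReal := by field_simp
  have hseq : Tendsto (fun n : ℕ => t / (n + 1 : ℝ)) atTop (𝓝[>] 0) := by
    refine tendsto_nhdsWithin_iff.2 ⟨?_, Eventually.of_forall fun n => by
      simp only [mem_Ioi]; positivity⟩
    simpa [div_eq_mul_inv] using (tendsto_one_div_add_atTop_nhds_zero_nat (𝕜 := ℝ)).const_mul t
  exact le_of_tendsto' ((((tendsto_slope_zero_of_hasDerivWithinAt_Ioi hv).comp hseq).norm.pow 2).mul_const t) key

end IsGradientFlow

end GradientFlow

/-! ### Bounding the initial energy by the `H¹` norm -/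

section InitialEnergy

variable {K : Set Plane} {𝒟 : Set (Plane → ℝ)}

theorem isBounded_square (L : ℝ) : Bornology.IsBounded (square L) := by
  refine isBounded_iff_forall_norm_le.2 ⟨√(∑ _i : Fin 2, L ^ 2), fun x hx => ?_⟩
  rw [EuclideanSpace.norm_eq]
  refine Real.sqrt_le_sqrt (Finset.sum_le_sum fun i _ => ?_)
  rw [Real.norm_eq_abs]
  exact pow_le_pow_left₀ (abs_nonneg _) (abs_le.2 ⟨(hx i).1.le, (hx i).2.le⟩) 2

theorem BoundarySetting.isBounded_and_contDiff (h : BoundarySetting K 𝒟) :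
    Bornology.IsBounded K ∧ ∀ φ ∈ 𝒟, ContDiff ℝ 1 φ := by
  cases h with
  | neumann _ hb => exact ⟨hb, fun φ hφ => hφ.1⟩
  | periodic _ => exact ⟨isBounded_square _, fun φ hφ => hφ.1⟩

theorem isFiniteMeasure_restrict_of_isBounded (hb : Bornology.IsBounded K) :
    IsFiniteMeasure ((volume : Measure Plane).restrict K) :=
  isFiniteMeasure_restrict.2 hb.measure_lt_top.ne

theorem integrable_of_bounded (hb : Bornology.IsBounded K) (f : L2 K) :
    Integrable f ((volume : Measure Plane).restrict K) :=
  have := isFiniteMeasure_restrict_of_isBounded hb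
  (Lp.memLp f).integrable (by norm_num)

/-- Compactness of the closure of `K` bounds `ψ` there; this covers periodic test functions, which
lack compact support. -/
theorem integrable_mul_continuous (hb : Bornology.IsBounded K) (f : L2 K) {ψ : Plane → ℝ}
    (hψ : Continuous ψ) :
    Integrable (fun x => f x * ψ x) ((volume : Measure Plane).restrict K) := by
  obtain ⟨C, hC⟩ := hb.isCompact_closure.exists_bound_of_continuousOn hψ.continuousOn
  refine (integrable_of_bounded hb f).mul_bdd (c := C) hψ.aestronglyMeasurable ?_
  refine ae_restrict_of_ae_restrict_of_subset subset_closure ?_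
  filter_upwards [ae_restrict_mem isClosed_closure.measurableSet] with x hx using hC x hx

theorem integral_sq_eq (f : L2 K) : ∫ x in K, f x ^ 2 = ‖f‖ ^ 2 := by
  rw [← real_inner_self_eq_norm_sq, L2.inner_def]
  simp [pow_two]

theorem integrable_sq (f : L2 K) :
    Integrable (fun x => f x ^ 2) ((volume : Measure Plane).restrict K) :=
  (Lp.memLp f).integrable_sq

theorem integral_abs_le (hb : Bornology.IsBounded K) (f : L2 K) :
    ∫ x in K, |f x| ≤ volume.real K / 2 + ‖f‖ ^ 2 / 2 := by
  have := isFiniteMeasure_restrict_of_isBounded hb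
  have h : ∫ x in K, |f x| ≤ ∫ x in K, (1 / 2 + f x ^ 2 / 2) := by
    refine integral_mono (integrable_of_bounded hb f).abs
      ((integrable_const _).add ((integrable_sq f).div_const 2)) fun x => ?_
    -- Young's inequality `|s| ≤ 1/2 + s²/2`.
    have := sq_nonneg (|f x| - 1)
    rw [sub_sq, sq_abs] at this
    simp only
    linarith
  rw [integral_add (integrable_const _) ((integrable_sq f).div_const 2), integral_div,
    integral_div, integral_sq_eq f] at h
  simpa [div_eq_mul_inv] using h

theorem sum_integral_abs_le (hb : Bornology.IsBounded K) {u : L2 K} {g : Fin 2 → L2 K} {M : ℝ}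
    (hM : ‖u‖ ^ 2 + ∑ i, ‖g i‖ ^ 2 ≤ M ^ 2) :
    ∑ i, ∫ x in K, |g i x| ≤ volume.real K + M ^ 2 / 2 := by
  have h0 := integral_abs_le hb (g 0)
  have h1 := integral_abs_le hb (g 1)
  have h2 := sq_nonneg ‖u‖
  rw [Fin.sum_univ_two] at hM ⊢
  linarith

theorem diffEnergy_le (hb : Bornology.IsBounded K) {γ M : ℝ} (hγ : 0 ≤ γ) {u : L2 K}
    (hu : H1NormLE K 𝒟 u M) :
    diffEnergy K 𝒟 γ u ≤ ENNReal.ofReal (γ / 2 * M ^ 2 + volume.real K + M ^ 2 / 2) := by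
  obtain ⟨-, g, hg, hM⟩ := hu
  refine (iInf₂_le g hg).trans (ENNReal.ofReal_le_ofReal ?_)
  rw [integral_add ((integrable_finsetSum _ fun i _ => integrable_sq (g i)).const_mul _)
    (integrable_finsetSum _ fun i _ => (integrable_of_bounded hb (g i)).abs),
    integral_const_mul, integral_finsetSum _ fun i _ => integrable_sq (g i),
    integral_finsetSum _ fun i _ => (integrable_of_bounded hb (g i)).abs]
  simp only [integral_sq_eq]
  have h1 := sum_integral_abs_le hb hM
  have h2 : γ / 2 * ∑ i, ‖g i‖ ^ 2 ≤ γ / 2 * M ^ 2 :=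
    mul_le_mul_of_nonneg_left (by linarith [sq_nonneg ‖u‖]) (by positivity)
  linarith

theorem anisoTV_le (hb : Bornology.IsBounded K) (h𝒟 : ∀ φ ∈ 𝒟, ContDiff ℝ 1 φ) {M : ℝ} {u : L2 K}
    (hu : H1NormLE K 𝒟 u M) :
    anisoTV K 𝒟 u ≤ ENNReal.ofReal (volume.real K + M ^ 2 / 2) := by
  obtain ⟨-, g, hg, hM⟩ := hu
  refine iSup₂_le fun z hz => ENNReal.ofReal_le_ofReal ?_
  have hcont : ∀ i, Continuous (partialDeriv i (z i)) := fun i =>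
    ((h𝒟 _ (hz.1 i)).continuous_fderiv one_ne_zero).clm_apply continuous_const
  simp only [Finset.mul_sum]
  rw [integral_finsetSum _ fun i _ => integrable_mul_continuous hb u (hcont i)]
  refine le_trans (Finset.sum_le_sum fun i _ => ?_) (sum_integral_abs_le hb hM)
  -- The weak gradient moves the derivative off `z i`; then `|z i| ≤ 1` leaves the `L¹` norm of `g
  -- i`.
  rw [hg i _ (hz.1 i), ← integral_neg]
  refine integral_mono (integrable_mul_continuous hb (g i) (h𝒟 _ (hz.1 i)).continuous).neg
    (integrable_of_bounded hb (g i)).abs fun x => ?_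
  calc -(g i x * z i x) ≤ |g i x * z i x| := neg_le_abs _
    _ = |g i x| * |z i x| := abs_mul _ _
    _ ≤ |g i x| := mul_le_of_le_one_right (abs_nonneg _) (hz.2 i x)

end InitialEnergy

end AnisoTV

theorem mainTheorem11 (K : Set AnisoTV.Plane) (𝒟 : Set (AnisoTV.Plane → ℝ))
    (hK : AnisoTV.BoundarySetting K 𝒟) (γ : ℝ) (hγ : 0 ≤ γ) (M : ℝ) :
    ∃ C : ℝ, ∀ u₀ : AnisoTV.L2 K, AnisoTV.H1NormLE K 𝒟 u₀ M →
      ∀ u : ℝ → AnisoTV.L2 K, AnisoTV.IsGradientFlow (AnisoTV.energy K 𝒟 γ) u₀ u →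
        ∀ t : ℝ, 0 < t →
          ∃ v : AnisoTV.L2 K, HasDerivWithinAt u v (Ioi t) t ∧ ‖v‖ ≤ C * t ^ (-(1 / 2) : ℝ) := by
  
  obtain ⟨hb, hc⟩ := AnisoTV.BoundarySetting.isBounded_and_contDiff hK
  set E : ℝ := γ / 2 * M ^ 2 + volume.real K + M ^ 2 / 2 with hE
  -- `E` bounds the initial energy for every `γ ≥ 0`; the 2 comes from the discrete dissipation
  -- inequality.
  refine ⟨√(2 * E), fun u₀ hu₀ u hu t ht => ?_⟩
  have hE0 : 0 ≤ E := by positivity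
  have hle : AnisoTV.energy K 𝒟 γ u₀ ≤ ENNReal.ofReal E := by
    unfold AnisoTV.energy
    split_ifs with h0
    · simpa [hE, h0] using AnisoTV.anisoTV_le hb (fun φ hφ => hc φ hφ) hu₀
    · exact AnisoTV.diffEnergy_le hb hγ hu₀
  obtain ⟨v, hv, hv2⟩ := hu.exists_mul_norm_sq_le (ne_top_of_le_ne_top ENNReal.ofReal_ne_top hle) ht
  refine ⟨v, hv, ?_⟩
  have h1 : (AnisoTV.energy K 𝒟 γ u₀).toReal ≤ E := ENNReal.toReal_le_of_le_ofReal hE0 hle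
  rw [Real.rpow_neg ht.le, ← Real.sqrt_eq_rpow, ← div_eq_mul_inv,
    ← Real.sqrt_div (by positivity)]
  apply Real.le_sqrt_of_sq_le
  rw [le_div_iff₀ ht]
  linarith
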